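/- Let $F:\mathbb Z\to\mathbb C$ satisfy $\sum_{n}|F(n)|<\infty$, $F(n)=\overline{F(-n)}$ for all $n$, and $F(n)=O\big(e^{-|n|^{2+\epsilon}}\big)$ as $|n|\to\infty$ for some $\epsilon>0$. For $t\in\mathbb R$ and $z\in\mathbb C$ put $f_t(z)=\sum_{n\in\mathbb Z}F(n)e^{tn^2}e^{inz}$. Then: (1) The series $f_t(z)$ converges absolutely for all $t\in\mathbb R$, $z\in\mathbb C$. (2) Let $\Delta\ge 0$. If all zeros $z$ of $f_0(z)=\sum_n F(n)e^{inz}$ satisfy $|\operatorname{Im} z|\le\Delta$, then for every real $t\ge 0$ all zeros $z$ of $f_t$ satisfy $|\operatorname{Im} z|\le \max(\Delta^2-2t,0)^{1/2}$. (3) In particular, if $t<t'$ are real and $f_t$ has only real zeros, then $f_{t'}$ has only real zeros. (4) Consequently the following holds for quadratic $L$-functions over function fields. Let $q$ be an odd prime power and let $D\in\mathbb F_q[T]$ be square-free and monic of odd degree $2g+1\ge 3$. Let $\chi_D(f)=\left(\frac Df\right)$ be the Kronecker symbol, $c_n=\sum_{f\text{ monic},\,\deg f=n}\chi_D(f)$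 (so that $L(s,\chi_D)=\sum_n c_nq^{-ns}$), $\Phi_n=c_{g-n}q^{n/2}$ for $0\le n\le g$, and $$\Xi_t(x,\chi_D)=\Phi_0+\sum_{n=1}^{g}\Phi_n e^{tn^2}\,(e^{inx}+e^{-inx}),\qquad t\in\mathbb R,\ x\in\mathbb C .$$ If $t<t'$ are real and $\Xi_t(\cdot,\chi_D)$ has only real zeros, then $\Xi_{t'}(\cdot,\chi_D)$ has only real zeros. -/

import Mathlib

open Filter Asymptotics
open scoped Polynomial

noncomputable section

/-- The trigonometric series `∑_{n ∈ ℤ} F(n) e^{inz}`, as a function of a complex variable. -/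
def trigSeries (F : ℤ → ℂ) (z : ℂ) : ℂ :=
  ∑' n : ℤ, F n * Complex.exp (Complex.I * n * z)

/-- The coefficients at time `t`: `n ↦ F(n) e^{t n²}`. -/
def deform (t : ℝ) (F : ℤ → ℂ) (n : ℤ) : ℂ :=
  F n * Complex.exp (t * (n : ℂ) ^ 2)

/-- All complex zeros of `f` are real. -/
def OnlyRealZeros (f : ℂ → ℂ) : Prop :=
  ∀ z : ℂ, f z = 0 → z.im = 0

section FunctionField

variable {K : Type*} [Field K]

/-- `(q, D)` is a good pair, where `q` is the cardinality of the finite field `K`: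
`q` is odd, `D ∈ K[T]` is square-free and monic, and `deg D` is odd and at least `3`. -/
structure IsGoodPair (K : Type*) [Field K] [Fintype K] (D : K[X]) : Prop where
  odd_card : Odd (Fintype.card K)
  squarefree : Squarefree D
  monic : D.Monic
  odd_natDegree : Odd D.natDegree
  three_le_natDegree : 3 ≤ D.natDegree

open Classical in
/-- The quadratic residue symbol `(D / P)` for an irreducible `P ∈ K[T]`: it is `0` if `P ∣ D`,
`1` if `D` is a nonzero square modulo `P`, and `-1` otherwise. -/
def residueSymbol (D P : K[X]) : ℤ :=
  if P ∣ D then 0 else if ∃ h : K[X], P ∣ D - h ^ 2 then 1 else -1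

open Classical in
/-- The quadratic character `χ_D(f) = (D / f)` (Kronecker symbol) for nonzero `f`: the product of
`(D / P)` over the monic irreducible factors `P` of `f`, with multiplicity. -/
def quadChar (D f : K[X]) : ℤ :=
  ((UniqueFactorizationMonoid.normalizedFactors f).map (residueSymbol D)).prod

/-- The coefficient `c_n = ∑ χ_D(f)`, over the monic `f` of degree `n`, of `(q^{-s})^n` in
`L(s, χ_D)`. Over a finite field the index set is finite. -/
def lCoeff (D : K[X]) (n : ℕ) : ℤ :=
  ∑ᶠ f ∈ {f : K[X] | f.Monic ∧ f.natDegree = n}, quadChar D f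

/-- `g = (deg D - 1) / 2`. -/
def genus (D : K[X]) : ℕ := (D.natDegree - 1) / 2

/-- For `0 ≤ n ≤ g`, the Fourier coefficient `Φ_n = c_{g-n} q^{n/2}`, i.e. the coefficient of
`e^{inx}` in `ξ(1/2 + i x / log q, χ_D)` where `ξ(s, χ_D) = q^{g s} L(s, χ_D)`. -/
def fourierPhi [Fintype K] (D : K[X]) (n : ℕ) : ℝ :=
  (lCoeff D (genus D - n) : ℝ) * (Fintype.card K : ℝ) ^ ((n : ℝ) / 2)

/-- `Ξ_t(x, χ_D) = Φ_0 + ∑_{n=1}^g Φ_n e^{t n²} (e^{inx} + e^{-inx})`. -/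
def Xi [Fintype K] (D : K[X]) (t : ℝ) (x : ℂ) : ℂ :=
  fourierPhi D 0 + ∑ n ∈ Finset.Icc 1 (genus D),
    (fourierPhi D n : ℂ) * Complex.exp (t * (n : ℂ) ^ 2) *
      (Complex.exp (Complex.I * n * x) + Complex.exp (-(Complex.I * n * x)))

end FunctionField

end

/-! The factor `e^{tn²}` is the limit of `cosh(an)^N` with `a = √(2t/N)`, and multiplying the
coefficients by `cosh(an)` replaces `f(z)` by `(f(z+ia) + f(z-ia))/2`. So it suffices that one such
averaging lowers the squared half-width `Δ²` of the zero strip by `a²` (down to zero at most); `N`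
steps lower it by `2t`, and a Hurwitz argument passes to the limit.

For one step, put `w = e^{iz}`. A strip becomes a compact annulus, so the Laurent series in `w` has
finitely many zeros there. Since `f` grows slower than `e^{ε|z|²}` for every `ε > 0`, removing them
leaves the exponential of a linear function (`SuperGaussian.exists_factorization`). At a zero of the
average, `|f(z+ia)| = |f(z-ia)|`, and by Hermitian symmetry the same holds at the conjugate points.
Multiplying the two equalities cancels the exponential, while each factor `e^{iz} - w` gives a
strict inequality outside the smaller strip (`norm_exp_sub_mul_lt`): a contradiction.

The polynomial `Ξ_t` is the case of real, even, finitely supported coefficients. -/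

/-! ### Decay, symmetry and operations on coefficient sequences -/

/-- `F` decays faster than every Gaussian. -/
def SuperGaussian (F : ℤ → ℂ) : Prop :=
  ∀ T : ℝ, Summable fun n : ℤ => ‖F n‖ * Real.exp (T * (n : ℝ) ^ 2)

/-- `F(n)` and `F(-n)` are complex conjugates. -/
def IsHermitianSeq (F : ℤ → ℂ) : Prop :=
  ∀ n : ℤ, F n = (starRingEnd ℂ) (F (-n))

/-- The coefficients `F(n) cosh(a n)` of `(f(z + ia) + f(z - ia)) / 2`. -/
noncomputable def coshMul (a : ℝ) (F : ℤ → ℂ) (n : ℤ) : ℂ :=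
  F n * (Real.cosh (a * n) : ℝ)

/-- The Laurent series `∑ F(n) w^n`. -/
noncomputable def laurentSeries (F : ℤ → ℂ) (w : ℂ) : ℂ := ∑' n : ℤ, F n * w ^ n

/-- Since `|n|^(2+ε) = n²|n|^ε` and `|n|^ε` eventually exceeds `T + 1`, the terms are eventually
`O(e^{-n²})`, hence `O(1/n²)`. -/
theorem superGaussian_of_isBigO {F : ℤ → ℂ} {ε : ℝ} (hε : 0 < ε)
    (h : F =O[cofinite] (fun n : ℤ => Real.exp (-(|(n : ℝ)| ^ (2 + ε))))) :
    SuperGaussian F := by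
  intro T
  have h2 : Summable fun n : ℤ => 1 / (n : ℝ) ^ 2 :=
    Real.summable_one_div_int_pow.2 one_lt_two
  refine summable_of_isBigO h2 ?_
  have h1 : (fun n : ℤ => ‖F n‖ * Real.exp (T * (n : ℝ) ^ 2)) =O[cofinite]
      fun n : ℤ => Real.exp (-(|(n : ℝ)| ^ (2 + ε))) * Real.exp (T * (n : ℝ) ^ 2) :=
    h.norm_left.mul (isBigO_refl _ _)
  refine h1.trans (IsBigO.of_bound 1 ?_)
  have habs : Tendsto (fun n : ℤ => |(n : ℝ)| ^ ε) cofinite atTop := by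
    refine (tendsto_rpow_atTop hε).comp ?_
    have := tendsto_norm_cocompact_atTop (E := ℝ) |>.comp (Int.tendsto_coe_cofinite)
    exact this
  filter_upwards [habs.eventually_ge_atTop (T + 1), (Set.finite_singleton (0 : ℤ)).compl_mem_cofinite]
    with n hn hn0
  have hn0 : (n : ℝ) ≠ 0 := by exact_mod_cast hn0
  have hpos : 0 < (n : ℝ) ^ 2 := by positivity
  have key : |(n : ℝ)| ^ (2 + ε) = (n : ℝ) ^ 2 * |(n : ℝ)| ^ ε := by
    rw [Real.rpow_add (abs_pos.2 hn0)]
    simp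
  rw [← Real.exp_add, key, one_mul, Real.norm_of_nonneg (Real.exp_pos _).le,
    Real.norm_of_nonneg (by positivity)]
  calc Real.exp (-((n : ℝ) ^ 2 * |(n : ℝ)| ^ ε) + T * (n : ℝ) ^ 2)
      ≤ Real.exp (-(n : ℝ) ^ 2) := by
        apply Real.exp_le_exp.2
        nlinarith
    _ = 1 / Real.exp ((n : ℝ) ^ 2) := by rw [Real.exp_neg, one_div]
    _ ≤ 1 / (n : ℝ) ^ 2 := by
        apply one_div_le_one_div_of_le hpos
        linarith [Real.add_one_le_exp ((n : ℝ) ^ 2)]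

theorem SuperGaussian.of_norm_le {F G : ℤ → ℂ} (hF : SuperGaussian F) (c : ℝ)
    (h : ∀ n, ‖G n‖ ≤ ‖F n‖ * Real.exp (c * (n : ℝ) ^ 2)) : SuperGaussian G := by
  intro T
  refine Summable.of_nonneg_of_le (fun n => by positivity) (fun n => ?_) (hF (c + T))
  rw [add_mul, Real.exp_add, ← mul_assoc]
  exact mul_le_mul_of_nonneg_right (h n) (Real.exp_pos _).le

theorem norm_deform (t : ℝ) (F : ℤ → ℂ) (n : ℤ) :
    ‖deform t F n‖ = ‖F n‖ * Real.exp (t * (n : ℝ) ^ 2) := by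
  rw [deform, norm_mul, Complex.norm_exp]
  congr 2
  rw [show (t : ℂ) * (n : ℂ) ^ 2 = ((t * (n : ℝ) ^ 2 : ℝ) : ℂ) by push_cast; ring,
    Complex.ofReal_re]

theorem SuperGaussian.deform {F : ℤ → ℂ} (hF : SuperGaussian F) (t : ℝ) :
    SuperGaussian (deform t F) :=
  hF.of_norm_le t fun n => (norm_deform t F n).le

theorem SuperGaussian.coshMul {F : ℤ → ℂ} (hF : SuperGaussian F) (a : ℝ) :
    SuperGaussian (coshMul a F) := by
  refine hF.of_norm_le (a ^ 2 / 2) fun n => ?_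
  rw [_root_.coshMul, norm_mul, Complex.norm_real, Real.norm_of_nonneg (Real.cosh_pos _).le]
  refine mul_le_mul_of_nonneg_left ((Real.cosh_le_exp_half_sq _).trans_eq ?_) (norm_nonneg _)
  congr 1
  ring

theorem IsHermitianSeq.deform {F : ℤ → ℂ} (hF : IsHermitianSeq F) (t : ℝ) :
    IsHermitianSeq (deform t F) := by
  intro n
  simp only [_root_.deform, map_mul, ← Complex.exp_conj, map_pow, Complex.conj_ofReal,
    map_intCast, ← hF n, Int.cast_neg, neg_sq]

theorem IsHermitianSeq.coshMul {F : ℤ → ℂ} (hF : IsHermitianSeq F) (a : ℝ) :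
    IsHermitianSeq (coshMul a F) := by
  intro n
  simp only [_root_.coshMul, map_mul, Complex.conj_ofReal, ← hF n, Int.cast_neg, mul_neg,
    Real.cosh_neg]

theorem deform_zero (F : ℤ → ℂ) : deform 0 F = F := by
  ext n
  simp [deform]

theorem deform_deform (s t : ℝ) (F : ℤ → ℂ) : deform s (deform t F) = deform (t + s) F := by
  ext n
  simp only [deform, mul_assoc, ← Complex.exp_add]
  congr 2
  push_cast
  ring

/-! ### Convergence, growth and holomorphy of the series -/

theorem SuperGaussian.summable_exp_abs {F : ℤ → ℂ} (hF : SuperGaussian F) (c : ℝ) :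
    Summable fun n : ℤ => ‖F n‖ * Real.exp (c * |(n : ℝ)|) := by
  refine Summable.of_nonneg_of_le (fun n => by positivity) (fun n => ?_)
    ((hF 1).mul_right (Real.exp (c ^ 2)))
  rw [mul_assoc, ← Real.exp_add]
  gcongr
  nlinarith [sq_abs (n : ℝ), sq_nonneg (c - |(n : ℝ)|), sq_nonneg (c + |(n : ℝ)|)]

theorem norm_exp_I_int_mul (n : ℤ) (z : ℂ) :
    ‖Complex.exp (Complex.I * n * z)‖ = Real.exp (-(n * z.im)) := by
  rw [Complex.norm_exp]
  congr 1
  simp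

theorem norm_exp_I_int_mul_le {R : ℝ} (n : ℤ) {z : ℂ} (hz : |z.im| ≤ R) :
    ‖Complex.exp (Complex.I * n * z)‖ ≤ Real.exp (R * |(n : ℝ)|) := by
  rw [norm_exp_I_int_mul]
  apply Real.exp_le_exp.2
  calc -((n : ℝ) * z.im) ≤ |(n : ℝ) * z.im| := neg_le_abs _
    _ = |z.im| * |(n : ℝ)| := by rw [abs_mul, mul_comm]
    _ ≤ R * |(n : ℝ)| := by gcongr

theorem SuperGaussian.summable_trig {F : ℤ → ℂ} (hF : SuperGaussian F) (z : ℂ) :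
    Summable fun n : ℤ => ‖F n * Complex.exp (Complex.I * n * z)‖ := by
  refine Summable.of_nonneg_of_le (fun n => norm_nonneg _) (fun n => ?_)
    (hF.summable_exp_abs |z.im|)
  rw [norm_mul]
  exact mul_le_mul_of_nonneg_left (norm_exp_I_int_mul_le n le_rfl) (norm_nonneg _)

/-- Completing the square gives `-ny ≤ n²/(4ε) + εy²`. The arbitrarily small `ε` is what later
excludes a quadratic term in the exponent of the zero-free factor. -/
theorem SuperGaussian.norm_trigSeries_le {F : ℤ → ℂ} (hF : SuperGaussian F) {ε : ℝ}
    (hε : 0 < ε) : ∃ C : ℝ, 0 < C ∧ ∀ z, ‖trigSeries F z‖ ≤ C * Real.exp (ε * z.im ^ 2) := by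
  refine ⟨(∑' n : ℤ, ‖F n‖ * Real.exp (1 / (4 * ε) * (n : ℝ) ^ 2)) + 1, ?_, fun z => ?_⟩
  · have : 0 ≤ ∑' n : ℤ, ‖F n‖ * Real.exp (1 / (4 * ε) * (n : ℝ) ^ 2) :=
      tsum_nonneg fun n => by positivity
    linarith
  · have h : ‖trigSeries F z‖ ≤
        ∑' n : ℤ, ‖F n‖ * Real.exp (1 / (4 * ε) * (n : ℝ) ^ 2) * Real.exp (ε * z.im ^ 2) := by
      refine tsum_of_norm_bounded ((hF _).mul_right _).hasSum fun n => ?_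
      rw [norm_mul, norm_exp_I_int_mul, mul_assoc, ← Real.exp_add]
      gcongr
      have : 0 ≤ (n + 2 * ε * z.im) ^ 2 / (4 * ε) := by positivity
      have h2 : (n + 2 * ε * z.im) ^ 2 / (4 * ε) =
        1 / (4 * ε) * (n : ℝ) ^ 2 + ε * z.im ^ 2 + n * z.im := by
        field_simp
        ring
      linarith
    rw [tsum_mul_right] at h
    refine h.trans ?_
    gcongr
    linarith

theorem trigSeries_eq_laurentSeries (F : ℤ → ℂ) (z : ℂ) :
    trigSeries F z = laurentSeries F (Complex.exp (Complex.I * z)) := by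
  refine tsum_congr fun n => ?_
  rw [← Complex.exp_int_mul]
  ring_nf

theorem SuperGaussian.differentiableOn_laurentSeries {F : ℤ → ℂ} (hF : SuperGaussian F) :
    DifferentiableOn ℂ (laurentSeries F) {0}ᶜ := by
  intro w hw
  have hw : w ≠ 0 := hw
  obtain ⟨R, hR⟩ := exists_gt |Real.log ‖w‖|
  let U : Set ℂ := {v | v ≠ 0 ∧ |Real.log ‖v‖| < R}
  have hU : IsOpen U := by
    rw [isOpen_iff_mem_nhds]
    rintro v ⟨hv0, hv⟩
    have hc : ContinuousAt (fun v : ℂ => |Real.log ‖v‖|) v :=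
      (continuousAt_id.norm.log (norm_ne_zero_iff.2 hv0)).abs
    filter_upwards [isOpen_ne.mem_nhds hv0, hc.eventually_lt continuousAt_const hv] with u h1 h2
    exact ⟨h1, h2⟩
  have hd : DifferentiableOn ℂ (laurentSeries F) U := by
    refine Complex.differentiableOn_tsum_of_summable_norm (hF.summable_exp_abs R)
      (fun n v hv => ?_) hU (fun n v hv => ?_)
    · exact ((differentiableAt_zpow.2 (Or.inl hv.1)).const_mul _).differentiableWithinAt
    · rw [norm_mul, norm_zpow]
      refine mul_le_mul_of_nonneg_left ?_ (norm_nonneg _)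
      have hv0 : 0 < ‖v‖ := norm_pos_iff.2 hv.1
      rw [← Real.rpow_intCast, Real.rpow_def_of_pos hv0]
      apply Real.exp_le_exp.2
      calc Real.log ‖v‖ * n ≤ |Real.log ‖v‖ * n| := le_abs_self _
        _ = |Real.log ‖v‖| * |(n : ℝ)| := abs_mul _ _
        _ ≤ R * |(n : ℝ)| := by gcongr; exact hv.2.le
  exact (hd.differentiableAt (hU.mem_nhds ⟨hw, hR⟩)).differentiableWithinAt

theorem SuperGaussian.differentiable_trigSeries {F : ℤ → ℂ} (hF : SuperGaussian F) :
    Differentiable ℂ (trigSeries F) := by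
  intro z
  have h1 : DifferentiableAt ℂ (laurentSeries F) (Complex.exp (Complex.I * z)) :=
    hF.differentiableOn_laurentSeries.differentiableAt
      (isOpen_compl_singleton.mem_nhds (Complex.exp_ne_zero _))
  have h2 : DifferentiableAt ℂ (fun z : ℂ => Complex.exp (Complex.I * z)) z := by fun_prop
  have h3 : trigSeries F = laurentSeries F ∘ fun z : ℂ => Complex.exp (Complex.I * z) :=
    funext fun y => trigSeries_eq_laurentSeries F y
  rw [h3]
  exact h1.comp z h2

theorem IsHermitianSeq.trigSeries_conj {F : ℤ → ℂ} (hF : IsHermitianSeq F) (z : ℂ) :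
    trigSeries F ((starRingEnd ℂ) z) = (starRingEnd ℂ) (trigSeries F z) := by
  unfold trigSeries
  rw [Complex.conj_tsum, ← (Equiv.neg ℤ).tsum_eq]
  refine tsum_congr fun n => ?_
  rw [map_mul, ← Complex.exp_conj, hF ((Equiv.neg ℤ) n)]
  simp

theorem SuperGaussian.trigSeries_coshMul {F : ℤ → ℂ} (hF : SuperGaussian F) (a : ℝ) (z : ℂ) :
    trigSeries (_root_.coshMul a F) z =
      (trigSeries F (z + a * Complex.I) + trigSeries F (z - a * Complex.I)) / 2 := by
  have h1 := (hF.summable_trig (z + a * Complex.I)).of_norm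
  have h2 := (hF.summable_trig (z - a * Complex.I)).of_norm
  unfold trigSeries
  rw [← h1.tsum_add h2, ← tsum_div_const]
  refine tsum_congr fun n => ?_
  have e1 : Complex.exp (Complex.I * n * (z + a * Complex.I)) =
      Complex.exp (Complex.I * n * z) * Complex.exp (-(a * n)) := by
    rw [← Complex.exp_add]
    congr 1
    linear_combination (a * n : ℂ) * Complex.I_sq
  have e2 : Complex.exp (Complex.I * n * (z - a * Complex.I)) =
      Complex.exp (Complex.I * n * z) * Complex.exp (a * n) := by
    rw [← Complex.exp_add]
    congr 1
    linear_combination -(a * n : ℂ) * Complex.I_sq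
  rw [e1, e2, _root_.coshMul]
  push_cast
  rw [Complex.cosh]
  ring

theorem integral_exp_int_mul_I (k : ℤ) :
    ∫ x in (0 : ℝ)..(2 * Real.pi), Complex.exp (Complex.I * k * x) =
      if k = 0 then 2 * Real.pi else 0 := by
  split_ifs with hk
  · simp [hk]
  · rw [integral_exp_mul_complex (by simp [hk])]
    rw [show Complex.I * (k : ℂ) * ((2 * Real.pi : ℝ) : ℂ) = k * (2 * Real.pi * Complex.I) by
      push_cast; ring, Complex.exp_int_mul_two_pi_mul_I]
    simp

/-- Orthogonality of characters on `[0, 2π]` recovers `F m`. This keeps the Hurwitz limit from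
vanishing identically. -/
theorem SuperGaussian.eq_zero_of_trigSeries_eq_zero {F : ℤ → ℂ} (hF : SuperGaussian F)
    (h : ∀ z, trigSeries F z = 0) (m : ℤ) : F m = 0 := by
  let f : ℤ → C(ℝ, ℂ) := fun n =>
    ⟨fun x : ℝ => F n * Complex.exp (Complex.I * ((n - m : ℤ) : ℂ) * x), by fun_prop⟩
  have hn : ∀ n (x : ℝ), ‖f n x‖ = ‖F n‖ := by
    intro n x
    change ‖F n * Complex.exp (Complex.I * ((n - m : ℤ) : ℂ) * x)‖ = _
    rw [norm_mul, norm_exp_I_int_mul]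
    simp
  have hs : Summable fun n : ℤ => ‖F n‖ := by simpa using hF 0
  have := intervalIntegral.hasSum_intervalIntegral_of_summable_norm (a := 0) (b := 2 * Real.pi)
    (f := f) (Summable.of_nonneg_of_le (fun n => norm_nonneg _) (fun n =>
      (ContinuousMap.norm_le _ (norm_nonneg _)).2 fun x => (hn n x).le) hs)
  have hz : ∀ x : ℝ, ∑' n, f n x = 0 := by
    intro x
    have := congrArg (· * Complex.exp (-(Complex.I * m * x))) (h x)
    simp only [trigSeries, zero_mul, ← tsum_mul_right] at this
    rw [← this]
    refine tsum_congr fun n => ?_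
    change F n * Complex.exp (Complex.I * ((n - m : ℤ) : ℂ) * x) = _
    rw [mul_assoc (F n), ← Complex.exp_add]
    congr 2
    push_cast
    ring
  have hi : ∀ n, ∫ x in (0 : ℝ)..(2 * Real.pi), f n x =
      if n = m then F n * (2 * Real.pi) else 0 := by
    intro n
    change ∫ x in (0 : ℝ)..(2 * Real.pi), F n * Complex.exp (Complex.I * ((n - m : ℤ) : ℂ) * x) = _
    rw [intervalIntegral.integral_const_mul, integral_exp_int_mul_I]
    split_ifs <;> simp_all [sub_eq_zero]
  simp only [hz, hi, intervalIntegral.integral_zero] at this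
  have h2 := (hasSum_ite_eq m (F m * (2 * Real.pi))).unique
    (this.congr_fun fun n => by split_ifs with h <;> simp [h])
  simpa [Real.pi_ne_zero] using h2

/-! ### Zero-free entire functions, division by zeros, limits of zeros -/

/-- A zero-free entire function of order less than two, or of order two and minimal type,
is the exponential of a linear function. -/
theorem exists_eq_exp_linear {E : ℂ → ℂ} (hE : Differentiable ℂ E) (h0 : ∀ z, E z ≠ 0)
    (hb : ∀ ε : ℝ, 0 < ε → ∃ C : ℝ, 0 < C ∧ ∀ z, ‖E z‖ ≤ C * Real.exp (ε * ‖z‖ ^ 2)) :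
    ∃ α β : ℂ, ∀ z, E z = Complex.exp (α * z + β) := by
  have hE' : Differentiable ℂ (deriv E) := hE.deriv
  have hL : Differentiable ℂ fun z => deriv E z / E z := hE'.div hE h0
  -- `H` is an entire logarithm of `E`, a primitive of `E'/E`; the goal is `H'' = 0`.
  obtain ⟨H, hH0, hH⟩ := hL.isExactOn_univ.with_val_at 0 (Complex.log (E 0))
  have hHd : Differentiable ℂ H := fun z => (hH z (Set.mem_univ z)).differentiableAt
  have hexp : ∀ z, E z = Complex.exp (H z) := by
    have hd : ∀ z, HasDerivAt (fun z => E z * Complex.exp (-H z)) 0 z := by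
      intro z
      have := (hE z).hasDerivAt.mul (hH z (Set.mem_univ z)).neg.cexp
      refine this.congr_deriv ?_
      have := h0 z
      field_simp
      ring
    intro z
    have hc := is_const_of_deriv_eq_zero (fun z => (hd z).differentiableAt)
      (fun z => (hd z).deriv) z 0
    simp only [hH0, Complex.exp_neg, Complex.exp_log (h0 0), mul_inv_cancel₀ (h0 0)] at hc
    have := Complex.exp_ne_zero (H z)
    field_simp at hc
    exact hc
  have hre : ∀ ε : ℝ, 0 < ε → ∃ C : ℝ, 0 < C ∧ ∀ z, (H z).re ≤ C + ε * ‖z‖ ^ 2 := by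
    intro ε hε
    obtain ⟨C, hC, h⟩ := hb ε hε
    refine ⟨|Real.log C| + 1, by positivity, fun z => ?_⟩
    have h1 := h z
    rw [hexp, Complex.norm_exp, ← Real.exp_log hC, ← Real.exp_add, Real.exp_le_exp] at h1
    linarith [le_abs_self (Real.log C)]
  have hnorm : ∀ ε : ℝ, 0 < ε → ∃ C : ℝ, 0 < C ∧ ∀ z, ‖H z‖ ≤ C + 8 * ε * (‖z‖ + 1) ^ 2 := by
    intro ε hε
    obtain ⟨C, hC, h⟩ := hre ε hε
    refine ⟨2 * C + 3 * ‖H 0‖, by positivity, fun z => ?_⟩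
    set r := ‖z‖ + 1 with hr
    have hr0 : 0 < r := by positivity
    have hM : 0 < C + ε * (2 * r) ^ 2 := by positivity
    -- Borel–Carathéodory on the disc of radius `2r > 2‖z‖` turns the bound on `Re H` into one on
    -- `‖H‖`, with both geometric ratios bounded (by 1 and 3).
    have := Complex.borelCaratheodory (R := 2 * r) (z := z) hM hHd.differentiableOn
      (fun w hw => (h w).trans (by
        have := (mem_ball_zero_iff.1 hw).le
        gcongr)) (by positivity) (mem_ball_zero_iff.2 (by linarith))
    refine this.trans ?_
    have hd : 0 < 2 * r - ‖z‖ := by linarith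
    have h1 : ‖z‖ / (2 * r - ‖z‖) ≤ 1 := (div_le_one hd).2 (by linarith)
    have h2 : (2 * r + ‖z‖) / (2 * r - ‖z‖) ≤ 3 := (div_le_iff₀ hd).2 (by linarith)
    rw [mul_div_assoc, mul_div_assoc]
    have h3 := mul_le_mul_of_nonneg_left h1 (by positivity : 0 ≤ 2 * (C + ε * (2 * r) ^ 2))
    have h4 := mul_le_mul_of_nonneg_left h2 (norm_nonneg (H 0))
    linarith
  have hsecond : ∀ c, deriv (deriv H) c = 0 := by
    intro c
    by_contra hne
    have hpos : 0 < ‖deriv (deriv H) c‖ := norm_pos_iff.2 hne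
    -- With 128, Cauchy's estimate on the circle of radius `R` about `c` reads `δR² ≤ 2C + δR²/2`,
    -- so `δR² ≤ 4C`; the choice of `R` gives `R ≥ 1` and `4C < δR`, a contradiction.
    obtain ⟨C, hC, h⟩ := hnorm (‖deriv (deriv H) c‖ / 128) (by positivity)
    set δ := ‖deriv (deriv H) c‖ with hδ
    set R := ‖c‖ + 1 + 4 * C / δ with hR
    have hR0 : 0 < R := by positivity
    have hR1 : 1 ≤ R := by
      have : 0 ≤ 4 * C / δ := by positivity
      linarith [norm_nonneg c]
    have hcR : ‖c‖ + 1 ≤ R := by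
      have : 0 ≤ 4 * C / δ := by positivity
      linarith
    have hCR : 4 * C < δ * R := by
      have : 4 * C / δ * δ = 4 * C := by field_simp
      nlinarith [norm_nonneg c]
    have hk := Complex.norm_iteratedDeriv_le_of_forall_mem_sphere_norm_le (c := c) (R := R)
      (C := C + 8 * (δ / 128) * (2 * R) ^ 2) 2 hR0 hHd.diffContOnCl (fun z hz => by
        refine (h z).trans ?_
        have h1 : ‖z - c‖ = R := mem_sphere_iff_norm.1 hz
        have h2 : ‖z‖ ≤ ‖z - c‖ + ‖c‖ := by simpa using norm_add_le (z - c) c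
        have h3 : ‖z‖ + 1 ≤ 2 * R := by linarith
        gcongr)
    rw [iteratedDeriv_succ, iteratedDeriv_one, ← hδ, le_div_iff₀ (by positivity)] at hk
    norm_num [Nat.factorial] at hk
    nlinarith
  have hconst : ∀ z, deriv H z = deriv H 0 := fun z =>
    is_const_of_deriv_eq_zero hHd.deriv hsecond z 0
  refine ⟨deriv H 0, H 0, fun z => ?_⟩
  have hd : ∀ z, HasDerivAt (fun z => H z - deriv H 0 * z) 0 z := by
    intro z
    have := (hHd z).hasDerivAt.sub ((hasDerivAt_id z).const_mul (deriv H 0))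
    refine this.congr_deriv ?_
    simp [hconst z]
  have hc := is_const_of_deriv_eq_zero (fun z => (hd z).differentiableAt)
    (fun z => (hd z).deriv) z 0
  rw [hexp]
  congr 1
  simp only [mul_zero, sub_zero] at hc
  linear_combination hc

/-- Induction on a finite set containing the zeros: a point that is a zero of order `n` is divided
out as `(w - a)^n`, any other point is dropped. The set `Z` may be larger than the zero set, which
keeps the induction simple. -/
theorem exists_eq_prod_mul_of_finite_zeros {U : Set ℂ} (hU : IsOpen U) (hc : IsPreconnected U)
    (Z : Finset ℂ) :
    ∀ {g : ℂ → ℂ}, DifferentiableOn ℂ g U → (∃ w ∈ U, g w ≠ 0) →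
      (∀ w ∈ U, g w = 0 → w ∈ Z) →
      ∃ (s : Multiset ℂ) (G : ℂ → ℂ), DifferentiableOn ℂ G U ∧ (∀ w ∈ U, G w ≠ 0) ∧
        (∀ v ∈ s, v ∈ U ∧ g v = 0) ∧
        ∀ w ∈ U, g w = (s.map fun v => w - v).prod * G w := by
  induction Z using Finset.induction_on with
  | empty =>
    intro g hg _ hZ
    exact ⟨0, g, hg, fun w hw h => by simpa using hZ w hw h, by simp, by simp⟩
  | insert a Z ha ih =>
    intro g hg hne hZ
    by_cases haU : a ∈ U ∧ g a = 0
    swap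
    · refine ih hg hne fun w hw h => ?_
      rcases Finset.mem_insert.1 (hZ w hw h) with rfl | h'
      · exact absurd ⟨hw, h⟩ haU
      · exact h'
    obtain ⟨haU, hga⟩ := haU
    have hgan : AnalyticOnNhd ℂ g U := hg.analyticOnNhd hU
    have hnz : ¬ ∀ᶠ z in nhds a, g z = 0 := by
      intro h
      obtain ⟨w, hw, hgw⟩ := hne
      exact hgw (hgan.eqOn_zero_of_preconnected_of_eventuallyEq_zero hc haU h hw)
    obtain ⟨n, φ, hφ, hφ0, hφe⟩ :=
      (hgan a haU).exists_eventuallyEq_pow_smul_nonzero_iff.2 hnz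
    let g₁ : ℂ → ℂ := Function.update (fun w => g w / (w - a) ^ n) a (φ a)
    have hg₁ne : ∀ w, w ≠ a → g₁ w = g w / (w - a) ^ n := fun w hw =>
      Function.update_of_ne hw _ _
    have hg₁a : g₁ a = φ a := Function.update_self _ _ _
    have hg₁φ : g₁ =ᶠ[nhds a] φ := by
      filter_upwards [hφe] with w hw
      rcases eq_or_ne w a with rfl | hwa
      · exact hg₁a
      · rw [hg₁ne w hwa, hw, smul_eq_mul, mul_div_cancel_left₀ _ (pow_ne_zero _ (sub_ne_zero.2 hwa))]
    have hfac : ∀ w, g w = (w - a) ^ n * g₁ w := by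
      intro w
      rcases eq_or_ne w a with rfl | hwa
      · rw [hg₁a, hφe.self_of_nhds, smul_eq_mul]
      · rw [hg₁ne w hwa, mul_div_cancel₀ _ (pow_ne_zero _ (sub_ne_zero.2 hwa))]
    have hg₁ : DifferentiableOn ℂ g₁ U := by
      intro w hw
      rcases eq_or_ne w a with rfl | hwa
      · exact (hφ.differentiableAt.congr_of_eventuallyEq hg₁φ).differentiableWithinAt
      · have h1 : DifferentiableAt ℂ (fun w => g w / (w - a) ^ n) w :=
          (hg.differentiableAt (hU.mem_nhds hw)).div (by fun_prop)
            (pow_ne_zero _ (sub_ne_zero.2 hwa))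
        refine (h1.congr_of_eventuallyEq ?_).differentiableWithinAt
        filter_upwards [isOpen_ne.mem_nhds hwa] with v hv using hg₁ne v hv
    obtain ⟨s, G, hG, hG0, hs, hsG⟩ := ih hg₁
      (by
        obtain ⟨w, hw, hgw⟩ := hne
        exact ⟨w, hw, fun h => hgw (by rw [hfac, h, mul_zero])⟩)
      (fun w hw h => by
        rcases Finset.mem_insert.1 (hZ w hw (by rw [hfac, h, mul_zero])) with rfl | h'
        · exact absurd (hg₁a ▸ h) hφ0
        · exact h')
    refine ⟨Multiset.replicate n a + s, G, hG, hG0, fun v hv => ?_, fun w hw => ?_⟩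
    · rcases Multiset.mem_add.1 hv with h | h
      · rw [Multiset.eq_of_mem_replicate h]
        exact ⟨haU, hga⟩
      · exact ⟨(hs v h).1, by rw [hfac, (hs v h).2, mul_zero]⟩
    · rw [hfac, hsG w hw, Multiset.map_add, Multiset.prod_add, Multiset.map_replicate,
        Multiset.prod_replicate, mul_assoc]

theorem finite_zeros_of_isCompact {U K : Set ℂ} (hU : IsOpen U) (hc : IsPreconnected U)
    (hK : IsCompact K) (hKU : K ⊆ U) {g : ℂ → ℂ} (hg : DifferentiableOn ℂ g U)
    (hne : ∃ w ∈ U, g w ≠ 0) : {w ∈ K | g w = 0}.Finite := by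
  by_contra hinf
  obtain ⟨a, haK, ha⟩ := Set.Infinite.exists_accPt_of_subset_isCompact hinf hK
    (Set.sep_subset _ _)
  obtain ⟨w, hw, hgw⟩ := hne
  refine hgw ((hg.analyticOnNhd hU).eqOn_zero_of_preconnected_of_frequently_eq_zero hc
    (hKU haK) ?_ hw)
  exact (accPt_iff_frequently_nhdsNE.1 ha).mono fun z hz => hz.2

/-- A weak form of Hurwitz's theorem: zeros of a nonzero limit are limits of zeros. -/
theorem mem_of_tendstoLocallyUniformly_of_zeros_subset {f : ℂ → ℂ} {fN : ℕ → ℂ → ℂ} {S : Set ℂ}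
    (hS : IsClosed S) (hf : Differentiable ℂ f) (hfN : ∀ N, Differentiable ℂ (fN N))
    (hlim : TendstoLocallyUniformly fN f atTop) (hne : ∃ z, f z ≠ 0)
    (hz : ∀ᶠ N in atTop, ∀ z, fN N z = 0 → z ∈ S) : ∀ z, f z = 0 → z ∈ S := by
  intro z₀ hz₀
  by_contra hzS
  have hiso : ∀ᶠ z in nhdsWithin z₀ {z₀}ᶜ, f z ≠ 0 := by
    rcases (hf.analyticAt z₀).eventually_eq_zero_or_eventually_ne_zero with h | h
    · obtain ⟨w, hw⟩ := hne
      exact absurd (AnalyticOnNhd.eqOn_zero_of_preconnected_of_eventuallyEq_zero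
        (fun z _ => hf.analyticAt z) isPreconnected_univ (Set.mem_univ z₀) h (Set.mem_univ w)) hw
    · exact h
  have hev : ∀ᶠ z in nhds z₀, (z ≠ z₀ → f z ≠ 0) ∧ z ∉ S :=
    (eventually_nhdsWithin_iff.1 hiso).and (hS.isOpen_compl.mem_nhds hzS)
  obtain ⟨r, hr, hball⟩ := Metric.nhds_basis_closedBall.eventually_iff.1 hev
  have hsph : (Metric.sphere z₀ r).Nonempty := NormedSpace.sphere_nonempty.2 hr.le
  obtain ⟨w, hw, hmin⟩ := (isCompact_sphere z₀ r).exists_isMinOn hsph hf.continuous.norm.continuousOn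
  have hwpos : 0 < ‖f w‖ := norm_pos_iff.2 ((hball (Metric.sphere_subset_closedBall hw)).1 fun h => by
    rw [h] at hw
    simp at hw
    linarith)
  have hu := (tendstoLocallyUniformly_iff_forall_isCompact.1 hlim) _ (isCompact_closedBall z₀ r)
  have hu' := Metric.tendstoUniformlyOn_iff.1 hu (‖f w‖ / 2) (by positivity)
  obtain ⟨N, hN1, hN2⟩ := (hu'.and hz).exists
  have hNne : ∀ z ∈ Metric.closedBall z₀ r, fN N z ≠ 0 := fun z hzb h =>
    (hball hzb).2 (hN2 z h)
  -- The maximum principle for `1/fN` on the zero-free disc gives `‖fN z₀‖ ≥ ‖f w‖/2`, where `‖f w‖`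
  -- is the minimum of `‖f‖` on the circle; yet `fN` is closer than that to `f z₀ = 0`.
  have hlow : ∀ z ∈ Metric.sphere z₀ r, ‖(fN N z)⁻¹‖ ≤ (‖f w‖ / 2)⁻¹ := by
    intro z hzs
    rw [norm_inv]
    apply inv_anti₀ (by positivity)
    have h1 := hN1 z (Metric.sphere_subset_closedBall hzs)
    rw [dist_eq_norm] at h1
    have h2 : ‖f w‖ ≤ ‖f z‖ := hmin hzs
    have h3 := norm_le_norm_add_norm_sub (fN N z) (f z)
    rw [norm_sub_rev] at h3
    linarith
  have hmax := Complex.norm_le_of_forall_mem_frontier_norm_le (U := Metric.ball z₀ r)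
    (f := fun z => (fN N z)⁻¹) Metric.isBounded_ball
    (by
      apply DifferentiableOn.diffContOnCl
      rw [closure_ball _ hr.ne']
      exact fun z hzb => ((hfN N z).inv (hNne z hzb)).differentiableWithinAt)
    (by rwa [frontier_ball _ hr.ne']) (subset_closure (Metric.mem_ball_self hr))
  rw [norm_inv] at hmax
  have h0 := hN1 z₀ (Metric.mem_closedBall_self hr.le)
  rw [hz₀, dist_zero_left] at h0
  have hpos := norm_pos_iff.2 (hNne z₀ (Metric.mem_closedBall_self hr.le))
  have := (inv_le_inv₀ hpos (by positivity)).1 hmax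
  linarith

/-! ### The strict inequality for a single factor -/

/-- The right side is the mean of `cosh(y ± a)`. The power series compare term by term, because `y²
+ a²` is the mean of `(y ± a)²` and `x ↦ xⁿ` is convex on `x ≥ 0`. -/
theorem cosh_sqrt_add_sq_le (y a : ℝ) :
    Real.cosh (√(y ^ 2 + a ^ 2)) ≤ Real.cosh y * Real.cosh a := by
  have h : Real.cosh y * Real.cosh a = (Real.cosh (y + a) + Real.cosh (y - a)) / 2 := by
    rw [Real.cosh_add, Real.cosh_sub]
    ring
  rw [h]
  refine hasSum_le (fun n => ?_) (Real.hasSum_cosh _)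
    (((Real.hasSum_cosh (y + a)).add (Real.hasSum_cosh (y - a))).div_const 2)
  rw [← add_div, div_right_comm]
  gcongr
  rw [pow_mul, pow_mul, pow_mul, Real.sq_sqrt (by positivity)]
  have := (convexOn_pow (𝕜 := ℝ) n).2 (Set.mem_Ici.2 (sq_nonneg (y + a)))
    (Set.mem_Ici.2 (sq_nonneg (y - a))) (by norm_num : (0 : ℝ) ≤ 1 / 2)
    (by norm_num : (0 : ℝ) ≤ 1 / 2) (by norm_num)
  simp only [smul_eq_mul] at this
  calc (y ^ 2 + a ^ 2) ^ n = (1 / 2 * (y + a) ^ 2 + 1 / 2 * (y - a) ^ 2) ^ n := by ring_nf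
    _ ≤ _ := this
    _ = _ := by ring

theorem cosh_lt_cosh_mul_cosh {d y a : ℝ} (h : d ^ 2 < y ^ 2 + a ^ 2) :
    Real.cosh d < Real.cosh y * Real.cosh a := by
  refine lt_of_lt_of_le (Real.cosh_lt_cosh.2 ?_) (cosh_sqrt_add_sq_le y a)
  rw [abs_of_nonneg (Real.sqrt_nonneg _), ← Real.sqrt_sq_eq_abs]
  exact Real.sqrt_lt_sqrt (sq_nonneg d) h

/-- The product of the two factors equals `2e^{ix}e^ζ (cosh(ζ - ix) - cosh v)`, so `v` enters only
through `cosh v`. -/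
theorem normSq_exp_sub_mul_exp_sub (x v : ℝ) (ζ : ℂ) :
    Complex.normSq ((Complex.exp (Complex.I * (x + v * Complex.I)) - Complex.exp ζ) *
      (Complex.exp (Complex.I * (x - v * Complex.I)) - Complex.exp ζ)) =
    4 * Complex.normSq (Complex.exp ζ) *
      ((Real.cosh v - Real.cosh ζ.re * Real.cos (x - ζ.im)) ^ 2 +
        (Real.sinh ζ.re * Real.sin (x - ζ.im)) ^ 2) := by
  have h1 : (Complex.exp (Complex.I * (x + v * Complex.I)) - Complex.exp ζ) *
      (Complex.exp (Complex.I * (x - v * Complex.I)) - Complex.exp ζ) =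
      Complex.exp (x * Complex.I) * Complex.exp ζ *
        (2 * (Complex.cosh (ζ - x * Complex.I) - Complex.cosh v)) := by
    have e1 : Complex.exp (Complex.I * (x + v * Complex.I)) =
        Complex.exp (x * Complex.I) * Complex.exp (-v) := by
      rw [← Complex.exp_add]
      congr 1
      linear_combination (v : ℂ) * Complex.I_sq
    have e2 : Complex.exp (Complex.I * (x - v * Complex.I)) =
        Complex.exp (x * Complex.I) * Complex.exp v := by
      rw [← Complex.exp_add]
      congr 1
      linear_combination -(v : ℂ) * Complex.I_sq
    rw [e1, e2, Complex.cosh, Complex.cosh, neg_sub, Complex.exp_sub, Complex.exp_sub,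
      Complex.exp_neg]
    have n1 := Complex.exp_ne_zero (x * Complex.I)
    have n2 := Complex.exp_ne_zero ζ
    have n3 := Complex.exp_ne_zero (v : ℂ)
    field_simp
    ring
  have h2 : Complex.cosh (ζ - x * Complex.I) - Complex.cosh v =
      ((Real.cosh ζ.re * Real.cos (x - ζ.im) - Real.cosh v : ℝ) : ℂ) +
        ((-(Real.sinh ζ.re * Real.sin (x - ζ.im)) : ℝ) : ℂ) * Complex.I := by
    have : ζ - x * Complex.I = ζ.re - ((x - ζ.im : ℝ) : ℂ) * Complex.I := by
      conv_lhs => rw [← Complex.re_add_im ζ]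
      push_cast
      ring
    rw [this, Complex.cosh_sub, Complex.cosh_mul_I, Complex.sinh_mul_I]
    push_cast
    ring
  rw [h1, h2, map_mul, map_mul, map_mul, Complex.normSq_add_mul_I,
    Complex.normSq_eq_norm_sq (Complex.exp (x * Complex.I)), Complex.norm_exp_ofReal_mul_I]
  simp only [Complex.normSq_ofNat]
  ring

/-- With `y = Im z`, `d = log ‖w‖` and `v = y ± a`, the `sinh·sin` terms agree, and the squared
terms differ by `4 sinh y sinh a (cosh y cosh a - cosh d cos θ)`, which is positive. -/
theorem norm_exp_sub_mul_lt {z w : ℂ} {a : ℝ} (hw : w ≠ 0) (hy : 0 < z.im) (ha : 0 < a)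
    (h : Real.log ‖w‖ ^ 2 < z.im ^ 2 + a ^ 2) :
    ‖Complex.exp (Complex.I * (z - a * Complex.I)) - w‖ *
        ‖Complex.exp (Complex.I * ((starRingEnd ℂ) z + a * Complex.I)) - w‖ <
      ‖Complex.exp (Complex.I * (z + a * Complex.I)) - w‖ *
        ‖Complex.exp (Complex.I * ((starRingEnd ℂ) z - a * Complex.I)) - w‖ := by
  have hz : z = z.re + z.im * Complex.I := (Complex.re_add_im z).symm
  have hz' : (starRingEnd ℂ) z = z.re - z.im * Complex.I := by
    apply Complex.ext <;> simp
  have h1 : z - a * Complex.I = z.re + ((z.im - a : ℝ) : ℂ) * Complex.I := by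
    conv_lhs => rw [hz]
    push_cast
    ring
  have h2 : (starRingEnd ℂ) z + a * Complex.I = z.re - ((z.im - a : ℝ) : ℂ) * Complex.I := by
    rw [hz']
    push_cast
    ring
  have h3 : z + a * Complex.I = z.re + ((z.im + a : ℝ) : ℂ) * Complex.I := by
    conv_lhs => rw [hz]
    push_cast
    ring
  have h4 : (starRingEnd ℂ) z - a * Complex.I = z.re - ((z.im + a : ℝ) : ℂ) * Complex.I := by
    rw [hz']
    push_cast
    ring
  rw [h1, h2, h3, h4, ← norm_mul, ← norm_mul]
  refine lt_of_pow_lt_pow_left₀ 2 (norm_nonneg _) ?_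
  rw [← Complex.normSq_eq_norm_sq, ← Complex.normSq_eq_norm_sq]
  rw [← Complex.exp_log hw, normSq_exp_sub_mul_exp_sub, normSq_exp_sub_mul_exp_sub,
    Complex.exp_log hw, Complex.log_re]
  have hpos : 0 < 4 * Complex.normSq w := by
    have := Complex.normSq_pos.2 hw
    positivity
  refine mul_lt_mul_of_pos_left ?_ hpos
  set θ := z.re - (Complex.log w).im
  set d := Real.log ‖w‖
  have hc := cosh_lt_cosh_mul_cosh h
  have hcos : Real.cosh d * Real.cos θ ≤ Real.cosh d :=
    mul_le_of_le_one_right (Real.cosh_pos _).le (Real.cos_le_one _)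
  have hs : 0 < Real.sinh z.im * Real.sinh a :=
    mul_pos (Real.sinh_pos_iff.2 hy) (Real.sinh_pos_iff.2 ha)
  rw [Real.cosh_add, Real.cosh_sub]
  nlinarith

/-! ### Factorization over the zeros in a strip -/

theorem Multiset.prod_map_le_and_lt {ι : Type*} (s : Multiset ι) {p q : ι → ℝ}
    (hp : ∀ i ∈ s, 0 ≤ p i) (h : ∀ i ∈ s, p i < q i) :
    0 ≤ (s.map p).prod ∧ (s.map p).prod ≤ (s.map q).prod ∧ 0 < (s.map q).prod ∧
      (s ≠ 0 → (s.map p).prod < (s.map q).prod) := by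
  induction s using Multiset.induction_on with
  | empty => simp
  | cons a s ih =>
    obtain ⟨h1, h2, h3, -⟩ := ih (fun i hi => hp i (Multiset.mem_cons_of_mem hi))
      (fun i hi => h i (Multiset.mem_cons_of_mem hi))
    have hpa := hp a (Multiset.mem_cons_self a s)
    have hlt := h a (Multiset.mem_cons_self a s)
    have hlt' : p a * (s.map p).prod < q a * (s.map q).prod := by nlinarith
    simp only [Multiset.map_cons, Multiset.prod_cons]
    exact ⟨mul_nonneg hpa h1, hlt'.le, mul_pos (hpa.trans_lt hlt) h3, fun _ => hlt'⟩

theorem Multiset.pow_card_le_prod_map {ι : Type*} (s : Multiset ι) {p : ι → ℝ} {c : ℝ}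
    (hc : 0 ≤ c) (h : ∀ i ∈ s, c ≤ p i) : c ^ Multiset.card s ≤ (s.map p).prod := by
  induction s using Multiset.induction_on with
  | empty => simp
  | cons a s ih =>
    simp only [Multiset.map_cons, Multiset.prod_cons, Multiset.card_cons, pow_succ']
    have ha := h a (Multiset.mem_cons_self a s)
    exact mul_le_mul ha (ih fun i hi => h i (Multiset.mem_cons_of_mem hi)) (by positivity)
      (hc.trans ha)

theorem norm_multiset_prod_map (s : Multiset ℂ) (u : ℂ) :
    ‖(s.map fun w => u - w).prod‖ = (s.map fun w => ‖u - w‖).prod := by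
  simpa [Multiset.map_map] using map_multiset_prod (normHom : ℂ →*₀ ℝ) (s.map fun w => u - w)

theorem isCompact_annulus {r : ℝ} (R : ℝ) : IsCompact {w : ℂ | r ≤ ‖w‖ ∧ ‖w‖ ≤ R} := by
  refine (isCompact_closedBall (0 : ℂ) R).of_isClosed_subset ?_ fun w hw => by simpa using hw.2
  exact (isClosed_le continuous_const continuous_norm).inter
    (isClosed_le continuous_norm continuous_const)

theorem isPreconnected_compl_zero : IsPreconnected ({0}ᶜ : Set ℂ) :=
  (isConnected_compl_singleton_of_one_lt_rank (by simp) 0).isPreconnected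

theorem norm_exp_I_mul (z : ℂ) : ‖Complex.exp (Complex.I * z)‖ = Real.exp (-z.im) := by
  simp [Complex.norm_exp]

/-- A trigonometric series with superexponentially decaying coefficients whose zeros lie in a
horizontal strip is a finite product times the exponential of a linear function. -/
theorem SuperGaussian.exists_factorization {F : ℤ → ℂ} (hF : SuperGaussian F) {Δ : ℝ}
    (hz : ∀ z : ℂ, trigSeries F z = 0 → |z.im| ≤ Δ) :
    ∃ (s : Multiset ℂ) (α β : ℂ), (∀ w ∈ s, w ≠ 0 ∧ |Real.log ‖w‖| ≤ Δ) ∧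
      ∀ z, trigSeries F z =
        (s.map fun w => Complex.exp (Complex.I * z) - w).prod * Complex.exp (α * z + β) := by
  have hU : IsOpen ({0}ᶜ : Set ℂ) := isOpen_compl_singleton
  have hg := hF.differentiableOn_laurentSeries
  have hzg : ∀ w : ℂ, w ≠ 0 → laurentSeries F w = 0 → |Real.log ‖w‖| ≤ Δ := by
    intro w hw h
    have he : Complex.exp (Complex.I * (-Complex.I * Complex.log w)) = w := by
      rw [← mul_assoc, mul_neg, Complex.I_mul_I, neg_neg, one_mul, Complex.exp_log hw]
    have := hz (-Complex.I * Complex.log w) (by rw [trigSeries_eq_laurentSeries, he, h])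
    simpa [Complex.log_re] using this
  have hne : ∃ w ∈ ({0}ᶜ : Set ℂ), laurentSeries F w ≠ 0 := by
    refine ⟨_, Complex.exp_ne_zero (Complex.I * ((Δ + 1 : ℝ) * Complex.I)), fun h => ?_⟩
    rw [← trigSeries_eq_laurentSeries] at h
    have := (le_abs_self _).trans (hz _ h)
    simp at this
    linarith
  have hKU : ∀ R : ℝ, {w : ℂ | Real.exp (-R) ≤ ‖w‖ ∧ ‖w‖ ≤ Real.exp R} ⊆ {0}ᶜ := by
    intro R w hw h
    rw [Set.mem_singleton_iff.1 h] at hw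
    have := Real.exp_pos (-R)
    simp at hw
    linarith [hw.1]
  have hfin := finite_zeros_of_isCompact hU isPreconnected_compl_zero
    (isCompact_annulus (r := Real.exp (-Δ)) (Real.exp Δ)) (hKU Δ) hg hne
  have hbd : ∀ w : ℂ, w ≠ 0 → |Real.log ‖w‖| ≤ Δ → Real.exp (-Δ) ≤ ‖w‖ ∧ ‖w‖ ≤ Real.exp Δ := by
    intro w hw h
    have hw0 := norm_pos_iff.2 hw
    obtain ⟨h1, h2⟩ := abs_le.1 h
    exact ⟨(Real.le_log_iff_exp_le hw0).1 h1, (Real.log_le_iff_le_exp hw0).1 h2⟩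
  obtain ⟨s, G, hG, hG0, hs, hsG⟩ := exists_eq_prod_mul_of_finite_zeros hU
    isPreconnected_compl_zero hfin.toFinset hg hne (fun w hw h => by
      rw [Set.Finite.mem_toFinset]
      exact ⟨hbd w hw (hzg w hw h), h⟩)
  have hfE : ∀ z, trigSeries F z = (s.map fun w => Complex.exp (Complex.I * z) - w).prod *
      G (Complex.exp (Complex.I * z)) := fun z => by
    rw [trigSeries_eq_laurentSeries]
    exact hsG _ (Complex.exp_ne_zero _)
  have hE : Differentiable ℂ fun z => G (Complex.exp (Complex.I * z)) := by
    intro z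
    have h1 : DifferentiableAt ℂ G (Complex.exp (Complex.I * z)) :=
      hG.differentiableAt (hU.mem_nhds (Complex.exp_ne_zero _))
    have h2 : DifferentiableAt ℂ (fun z : ℂ => Complex.exp (Complex.I * z)) z := by fun_prop
    exact h1.comp z h2
  obtain ⟨M, hM⟩ := (isCompact_annulus (r := Real.exp (-(Δ + 1)))
    (Real.exp (Δ + 1))).exists_bound_of_continuousOn (hG.continuousOn.mono (hKU (Δ + 1)))
  have e1 : Real.exp (-(Δ + 1)) < Real.exp (-Δ) := Real.exp_lt_exp.2 (by linarith)
  have e2 : Real.exp Δ < Real.exp (Δ + 1) := Real.exp_lt_exp.2 (by linarith)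
  -- `c` bounds from below the distance between the annulus of zeros and any `e^{iz}` with `|Im z| >
  -- Δ + 1`.
  obtain ⟨c, hc0, hc1, hc2⟩ : ∃ c : ℝ, 0 < c ∧ c ≤ Real.exp (-Δ) - Real.exp (-(Δ + 1)) ∧
      c ≤ Real.exp (Δ + 1) - Real.exp Δ :=
    ⟨_, lt_min (sub_pos.2 e1) (sub_pos.2 e2), min_le_left _ _, min_le_right _ _⟩
  have hlow : ∀ z : ℂ, Δ + 1 < |z.im| →
      c ^ Multiset.card s ≤ ‖(s.map fun w => Complex.exp (Complex.I * z) - w).prod‖ := by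
    intro z hzim
    rw [norm_multiset_prod_map]
    refine Multiset.pow_card_le_prod_map s hc0.le fun v hv => ?_
    obtain ⟨b1, b2⟩ := hbd v (hs v hv).1 (hzg v (hs v hv).1 (hs v hv).2)
    have hne := norm_exp_I_mul z
    rcases lt_abs.1 hzim with h | h
    · have h3 : Real.exp (-z.im) ≤ Real.exp (-(Δ + 1)) := Real.exp_le_exp.2 (by linarith)
      have := norm_sub_norm_le v (Complex.exp (Complex.I * z))
      rw [norm_sub_rev] at this
      linarith
    · have h3 : Real.exp (Δ + 1) ≤ Real.exp (-z.im) := Real.exp_le_exp.2 (by linarith)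
      have := norm_sub_norm_le (Complex.exp (Complex.I * z)) v
      linarith
  obtain ⟨α, β, hαβ⟩ := exists_eq_exp_linear hE (fun z => hG0 _ (Complex.exp_ne_zero _))
    (fun ε hε => by
      obtain ⟨C, hC, hCb⟩ := hF.norm_trigSeries_le hε
      have hck : 0 < c ^ Multiset.card s := by positivity
      refine ⟨C / c ^ Multiset.card s + |M|, by positivity, fun z => ?_⟩
      -- In the wider strip `e^{iz}` stays in a compact annulus where `G` is bounded; outside it the
      -- product is at least `c ^ card s`, so the growth bound for the series passes to `G`.
      rcases le_or_gt |z.im| (Δ + 1) with h | h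
      · have h1 := hM (Complex.exp (Complex.I * z)) (by
          rw [Set.mem_ofPred_eq, norm_exp_I_mul, Real.exp_le_exp, Real.exp_le_exp]
          have := abs_le.1 h
          constructor <;> linarith)
        have h2 : 1 ≤ Real.exp (ε * ‖z‖ ^ 2) := Real.one_le_exp (by positivity)
        have h3 : 0 ≤ C / c ^ Multiset.card s := by positivity
        have h4 := le_abs_self M
        nlinarith [abs_nonneg M]
      · have h1 := hCb z
        rw [hfE, norm_mul] at h1
        have h2 := hlow z h
        have h3 : ‖G (Complex.exp (Complex.I * z))‖ ≤
            C / c ^ Multiset.card s * Real.exp (ε * z.im ^ 2) := by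
          rw [div_mul_eq_mul_div, le_div_iff₀ hck, mul_comm]
          exact (mul_le_mul_of_nonneg_right h2 (norm_nonneg _)).trans h1
        have h5 : z.im ^ 2 ≤ ‖z‖ ^ 2 := by
          rw [← sq_abs]
          gcongr
          exact Complex.abs_im_le_norm z
        refine h3.trans ?_
        gcongr
        linarith [abs_nonneg M])
  exact ⟨s, α, β, fun w hw => ⟨(hs w hw).1, hzg w (hs w hw).1 (hs w hw).2⟩, fun z => by
    rw [hfE, ← hαβ]⟩

/-! ### One averaging step -/

theorem trigSeries_coshMul_ne_zero {F : ℤ → ℂ} (hF : SuperGaussian F) (hH : IsHermitianSeq F)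
    {Δ a : ℝ} (ha : 0 < a) (hz : ∀ z : ℂ, trigSeries F z = 0 → |z.im| ≤ Δ) {z : ℂ}
    (hy : 0 < z.im) (h : Δ ^ 2 < z.im ^ 2 + a ^ 2) : trigSeries (coshMul a F) z ≠ 0 := by
  intro h0
  rw [hF.trigSeries_coshMul, div_eq_zero_iff, or_iff_left two_ne_zero] at h0
  obtain ⟨s, α, β, hs, hfac⟩ := hF.exists_factorization hz
  rcases eq_or_ne s 0 with rfl | hs0
  -- With no zeros there is no strict inequality. But then the series is `e^{αz+β}`; its period `2π`
  -- forces `Re α = 0` and its Hermitian symmetry forces `Im α = 0`, so the average is a nonzero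
  -- constant.
  · simp only [Multiset.map_zero, Multiset.prod_zero, one_mul] at hfac
    have hre : α.re = 0 := by
      have h1 : trigSeries F (2 * Real.pi) = trigSeries F 0 := by
        rw [trigSeries_eq_laurentSeries, trigSeries_eq_laurentSeries, mul_zero, Complex.exp_zero,
          mul_comm, Complex.exp_two_pi_mul_I]
      have h2 := congrArg norm h1
      rw [hfac, hfac, Complex.norm_exp, Complex.norm_exp, Real.exp_eq_exp] at h2
      simpa [Real.pi_ne_zero] using h2
    have him : α.im = 0 := by
      have h1 := congrArg norm (hH.trigSeries_conj Complex.I)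
      rw [RCLike.norm_conj, hfac, hfac, Complex.norm_exp, Complex.norm_exp, Real.exp_eq_exp] at h1
      simp at h1
      linarith
    have hα : α = 0 := Complex.ext hre him
    rw [hfac, hfac, hα] at h0
    simp [Complex.exp_ne_zero] at h0
  · have e1 : ‖trigSeries F (z + a * Complex.I)‖ = ‖trigSeries F (z - a * Complex.I)‖ := by
      rw [eq_neg_of_add_eq_zero_left h0, norm_neg]
    have e2 : ‖trigSeries F ((starRingEnd ℂ) z - a * Complex.I)‖ =
        ‖trigSeries F (z + a * Complex.I)‖ := by
      rw [← RCLike.norm_conj, ← hH.trigSeries_conj]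
      simp
    have e3 : ‖trigSeries F ((starRingEnd ℂ) z + a * Complex.I)‖ =
        ‖trigSeries F (z - a * Complex.I)‖ := by
      rw [← RCLike.norm_conj, ← hH.trigSeries_conj]
      simp [sub_eq_add_neg]
    have hAB : ‖trigSeries F (z - a * Complex.I)‖ *
          ‖trigSeries F ((starRingEnd ℂ) z + a * Complex.I)‖ =
        ‖trigSeries F (z + a * Complex.I)‖ *
          ‖trigSeries F ((starRingEnd ℂ) z - a * Complex.I)‖ := by
      rw [e2, e3, e1]
    have hprod : ∀ z₁ z₂ : ℂ, ‖trigSeries F z₁‖ * ‖trigSeries F z₂‖ =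
        (s.map fun w => ‖Complex.exp (Complex.I * z₁) - w‖ *
          ‖Complex.exp (Complex.I * z₂) - w‖).prod * ‖Complex.exp (α * (z₁ + z₂) + 2 * β)‖ := by
      intro z₁ z₂
      rw [hfac, hfac, norm_mul, norm_mul, norm_multiset_prod_map, norm_multiset_prod_map,
        Multiset.prod_map_mul, mul_mul_mul_comm, ← norm_mul, ← Complex.exp_add]
      ring_nf
    rw [hprod, hprod] at hAB
    -- Both pairs of points have the sum `z + conj z`, so the unknown exponential factor is the same
    -- on the two sides.
    have hsum : z - a * Complex.I + ((starRingEnd ℂ) z + a * Complex.I) =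
        z + a * Complex.I + ((starRingEnd ℂ) z - a * Complex.I) := by ring
    rw [hsum] at hAB
    have hAB' := mul_right_cancel₀ (norm_ne_zero_iff.2 (Complex.exp_ne_zero _)) hAB
    refine ((Multiset.prod_map_le_and_lt s (fun w _ => by positivity) fun w hw => ?_).2.2.2
      hs0).ne hAB'
    refine norm_exp_sub_mul_lt (hs w hw).1 hy ha (lt_of_le_of_lt ?_ h)
    rw [← sq_abs]
    have := (hs w hw).2
    gcongr

/-- One step of narrowing the strip that contains the zeros. -/
theorem abs_im_le_of_trigSeries_coshMul_eq_zero {F : ℤ → ℂ} (hF : SuperGaussian F)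
    (hH : IsHermitianSeq F) {Δ a : ℝ} (ha : 0 < a)
    (hz : ∀ z : ℂ, trigSeries F z = 0 → |z.im| ≤ Δ) (z : ℂ)
    (h0 : trigSeries (coshMul a F) z = 0) : |z.im| ≤ √(max (Δ ^ 2 - a ^ 2) 0) := by
  by_contra! hlt
  have hsq : max (Δ ^ 2 - a ^ 2) 0 < |z.im| ^ 2 := by
    rwa [← Real.sqrt_lt' ((Real.sqrt_nonneg _).trans_lt hlt)]
  have h1 : Δ ^ 2 < z.im ^ 2 + a ^ 2 := by
    have := (le_max_left (Δ ^ 2 - a ^ 2) 0).trans_lt hsq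
    rw [sq_abs] at this
    linarith
  rcases lt_trichotomy z.im 0 with h | h | h
  · refine trigSeries_coshMul_ne_zero hF hH ha hz (z := (starRingEnd ℂ) z) (by simpa using h)
      (by simpa using h1) ?_
    rw [(hH.coshMul a).trigSeries_conj, h0, map_zero]
  · have := (le_max_right (Δ ^ 2 - a ^ 2) 0).trans_lt hsq
    simp [h] at this
  · exact trigSeries_coshMul_ne_zero hF hH ha hz h h1 h0

/-! ### Iteration and passage to the limit -/

theorem iterate_coshMul (a : ℝ) (F : ℤ → ℂ) (N : ℕ) (n : ℤ) :
    (coshMul a)^[N] F n = F n * ((Real.cosh (a * n) ^ N : ℝ) : ℂ) := by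
  induction N with
  | zero => simp
  | succ N ih =>
    rw [Function.iterate_succ_apply', coshMul, ih]
    push_cast
    ring

theorem iterate_coshMul_zeros {F : ℤ → ℂ} (hF : SuperGaussian F) (hH : IsHermitianSeq F)
    {Δ a : ℝ} (hΔ : 0 ≤ Δ) (ha : 0 < a) (hz : ∀ z : ℂ, trigSeries F z = 0 → |z.im| ≤ Δ) (N : ℕ) :
    SuperGaussian ((coshMul a)^[N] F) ∧ IsHermitianSeq ((coshMul a)^[N] F) ∧
      ∀ z : ℂ, trigSeries ((coshMul a)^[N] F) z = 0 →
        |z.im| ≤ √(max (Δ ^ 2 - N * a ^ 2) 0) := by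
  induction N with
  | zero =>
    refine ⟨hF, hH, fun z h => (hz z h).trans ?_⟩
    simp [max_eq_left (sq_nonneg Δ), Real.sqrt_sq hΔ]
  | succ N ih =>
    obtain ⟨h1, h2, h3⟩ := ih
    rw [Function.iterate_succ_apply']
    refine ⟨h1.coshMul a, h2.coshMul a, fun z h => ?_⟩
    refine (abs_im_le_of_trigSeries_coshMul_eq_zero h1 h2 ha h3 z h).trans (Real.sqrt_le_sqrt ?_)
    rw [Real.sq_sqrt (le_max_right _ _)]
    push_cast
    refine max_le ?_ (le_max_right _ _)
    rcases le_total (Δ ^ 2 - N * a ^ 2) 0 with h | h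
    · rw [max_eq_right h]
      exact le_max_of_le_right (by nlinarith)
    · rw [max_eq_left h]
      exact le_max_of_le_left (by linarith)

theorem one_add_half_sq_le_cosh (x : ℝ) : 1 + x ^ 2 / 2 ≤ Real.cosh x := by
  have h : Real.cosh x = 1 + 2 * Real.sinh (x / 2) ^ 2 := by
    have := Real.cosh_two_mul (x / 2)
    rw [mul_div_cancel₀ x two_ne_zero, Real.cosh_sq] at this
    linarith
  have h2 : (x / 2) ^ 2 ≤ Real.sinh (x / 2) ^ 2 := by
    rw [sq_le_sq, Real.abs_sinh]
    exact Real.self_le_sinh_iff.2 (abs_nonneg _)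
  linarith

theorem cosh_pow_le_exp {t : ℝ} (ht : 0 ≤ t) (x : ℝ) (N : ℕ) :
    Real.cosh (√(2 * t / N) * x) ^ N ≤ Real.exp (t * x ^ 2) := by
  rcases N.eq_zero_or_pos with rfl | hN
  · simpa using by positivity
  have hN' : (0 : ℝ) < N := by exact_mod_cast hN
  calc Real.cosh (√(2 * t / N) * x) ^ N ≤ Real.exp ((√(2 * t / N) * x) ^ 2 / 2) ^ N := by
        gcongr
        exact Real.cosh_le_exp_half_sq _
    _ = Real.exp (t * x ^ 2) := by
        rw [← Real.exp_nat_mul, mul_pow, Real.sq_sqrt (by positivity)]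
        congr 1
        field_simp

/-- Squeezed between `(1 + tx²/N)^N` and `e^{tx²}`; the upper bound, valid for every `N`, also
supplies the domination in the limit of the series. -/
theorem tendsto_cosh_pow {t : ℝ} (ht : 0 ≤ t) (x : ℝ) :
    Tendsto (fun N : ℕ => Real.cosh (√(2 * t / N) * x) ^ N) atTop
      (nhds (Real.exp (t * x ^ 2))) := by
  refine tendsto_of_tendsto_of_tendsto_of_le_of_le
    (Real.tendsto_one_add_div_pow_exp (t * x ^ 2)) tendsto_const_nhds (fun N => ?_)
    (fun N => cosh_pow_le_exp ht x N)
  have h := one_add_half_sq_le_cosh (√(2 * t / N) * x)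
  rw [mul_pow, Real.sq_sqrt (by positivity)] at h
  dsimp only
  gcongr
  refine le_trans (le_of_eq ?_) h
  ring

theorem tendstoLocallyUniformly_trigSeries {F : ℤ → ℂ} (hF : SuperGaussian F) {t : ℝ}
    (ht : 0 ≤ t) :
    TendstoLocallyUniformly
      (fun N : ℕ => trigSeries ((coshMul √(2 * t / N))^[N] F)) (trigSeries (deform t F)) atTop := by
  rw [tendstoLocallyUniformly_iff_forall_isCompact]
  intro K hK
  obtain ⟨R, hR⟩ := hK.exists_bound_of_continuousOn Complex.continuous_im.continuousOn
  -- `d N n` majorizes the difference of the `n`-th terms uniformly for `|Im z| ≤ R`; its sum over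
  -- `n` tends to zero by dominated convergence.
  let d : ℕ → ℤ → ℝ := fun N n => ‖F n‖ *
    (Real.exp (t * (n : ℝ) ^ 2) - Real.cosh (√(2 * t / N) * n) ^ N) * Real.exp (R * |(n : ℝ)|)
  have hd0 : ∀ N n, 0 ≤ d N n := fun N n =>
    mul_nonneg (mul_nonneg (norm_nonneg _) (sub_nonneg.2 (cosh_pow_le_exp ht _ N)))
      (Real.exp_pos _).le
  have hdle : ∀ N n, d N n ≤ ‖deform t F n‖ * Real.exp (R * |(n : ℝ)|) := by
    intro N n
    rw [norm_deform]
    have : 0 ≤ Real.cosh (√(2 * t / N) * n) ^ N := pow_nonneg (Real.cosh_pos _).le _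
    dsimp only [d]
    gcongr
    linarith
  have hbs := (hF.deform t).summable_exp_abs R
  have hds : ∀ N, Summable (d N) := fun N => Summable.of_nonneg_of_le (hd0 N) (hdle N) hbs
  have hlim : Tendsto (fun N => ∑' n, d N n) atTop (nhds 0) := by
    rw [← tsum_zero (α := ℝ) (β := ℤ)]
    refine tendsto_tsum_of_dominated_convergence hbs (fun n => ?_)
      (Eventually.of_forall fun N n => ?_)
    · have := (((tendsto_cosh_pow ht (n : ℝ)).const_sub
        (Real.exp (t * (n : ℝ) ^ 2))).const_mul ‖F n‖).mul_const (Real.exp (R * |(n : ℝ)|))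
      simpa only [sub_self, mul_zero, zero_mul] using this
    · rw [Real.norm_of_nonneg (hd0 N n)]
      exact hdle N n
  rw [Metric.tendstoUniformlyOn_iff]
  intro ε hε
  filter_upwards [hlim.eventually_lt_const hε] with N hN z hz
  refine lt_of_le_of_lt ?_ hN
  have hs1 := ((hF.deform t).summable_trig z).of_norm
  have hle : ∀ n, ‖deform t F n * Complex.exp (Complex.I * n * z) -
      (coshMul √(2 * t / N))^[N] F n * Complex.exp (Complex.I * n * z)‖ ≤ d N n := by
    intro n
    rw [← sub_mul, norm_mul]
    refine mul_le_mul (le_of_eq ?_) (norm_exp_I_int_mul_le n (hR z hz)) (norm_nonneg _)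
      (mul_nonneg (norm_nonneg _) (sub_nonneg.2 (cosh_pow_le_exp ht _ N)))
    rw [iterate_coshMul, deform, ← mul_sub, norm_mul,
      show Complex.exp ((t : ℂ) * (n : ℂ) ^ 2) = ((Real.exp (t * (n : ℝ) ^ 2) : ℝ) : ℂ) by
        push_cast; rfl, ← Complex.ofReal_sub, Complex.norm_real,
      Real.norm_of_nonneg (sub_nonneg.2 (cosh_pow_le_exp ht _ N))]
  have hs2 : Summable fun n : ℤ =>
      (coshMul √(2 * t / N))^[N] F n * Complex.exp (Complex.I * n * z) := by
    have h := (hds N).of_norm_bounded hle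
    simpa using hs1.sub h
  rw [dist_eq_norm, trigSeries, trigSeries, ← hs1.tsum_sub hs2]
  exact tsum_of_norm_bounded (hds N).hasSum hle

/-- De Bruijn's theorem for trigonometric series: the heat flow narrows the strip that contains
the zeros. -/
theorem abs_im_le_of_trigSeries_deform_eq_zero {F : ℤ → ℂ} (hF : SuperGaussian F)
    (hH : IsHermitianSeq F) {Δ : ℝ} (hΔ : 0 ≤ Δ)
    (hz : ∀ z : ℂ, trigSeries F z = 0 → |z.im| ≤ Δ) {t : ℝ} (ht : 0 ≤ t) (z : ℂ)
    (h0 : trigSeries (deform t F) z = 0) : |z.im| ≤ √(max (Δ ^ 2 - 2 * t) 0) := by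
  -- At `t = 0` the shift `a` would vanish, while the averaging step needs `a > 0`.
  rcases ht.eq_or_lt with rfl | ht'
  · rw [deform_zero] at h0
    simpa [max_eq_left (sq_nonneg Δ), Real.sqrt_sq hΔ] using hz z h0
  have hne : ∃ z, trigSeries (deform t F) z ≠ 0 := by
    by_contra! hall
    have hF0 : ∀ n, F n = 0 := fun n => by
      simpa [deform, Complex.exp_ne_zero] using (hF.deform t).eq_zero_of_trigSeries_eq_zero hall n
    have := hz ((Δ + 1 : ℝ) * Complex.I) (by simp [trigSeries, hF0])
    simp only [Complex.im_ofReal_mul, Complex.I_im, mul_one] at this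
    linarith [le_abs_self (Δ + 1)]
  have ha : ∀ N : ℕ, 0 < N → 0 < √(2 * t / N) := fun N hN => by positivity
  have hstep : ∀ N : ℕ, 0 < N → _ := fun N hN =>
    iterate_coshMul_zeros hF hH hΔ (ha N hN) hz N
  have hclosed : IsClosed {z : ℂ | |z.im| ≤ √(max (Δ ^ 2 - 2 * t) 0)} :=
    isClosed_le Complex.continuous_im.abs continuous_const
  refine mem_of_tendstoLocallyUniformly_of_zeros_subset hclosed
    (hF.deform t).differentiable_trigSeries (fun N => ?_)
    (tendstoLocallyUniformly_trigSeries hF ht) hne ?_ z h0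
  -- For `N = 0` the shift is `√(2t/0) = 0`, but no averaging takes place and the series is that of
  -- `F`.
  · rcases N.eq_zero_or_pos with rfl | hN
    · exact hF.differentiable_trigSeries
    · exact (hstep N hN).1.differentiable_trigSeries
  · filter_upwards [eventually_gt_atTop 0] with N hN w hw
    have := (hstep N hN).2.2 w hw
    have hN' : (N : ℝ) ≠ 0 := by exact_mod_cast hN.ne'
    rwa [Real.sq_sqrt (by positivity), mul_div_cancel₀ _ hN'] at this

theorem onlyRealZeros_deform_of_lt {F : ℤ → ℂ} (hF : SuperGaussian F) (hH : IsHermitianSeq F)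
    {t t' : ℝ} (h : t < t') (hz : OnlyRealZeros (trigSeries (deform t F))) :
    OnlyRealZeros (trigSeries (deform t' F)) := by
  intro z h0
  have e : deform t' F = deform (t' - t) (deform t F) := by
    rw [deform_deform]
    ring_nf
  rw [e] at h0
  have := abs_im_le_of_trigSeries_deform_eq_zero (hF.deform t) (hH.deform t) le_rfl
    (fun w hw => by simp [hz w hw]) (sub_nonneg.2 h.le) z h0
  rw [max_eq_right (by linarith), Real.sqrt_zero] at this
  exact abs_nonpos_iff.1 this

/-! ### The function-field case -/

section FunctionField

variable {K : Type*} [Field K] [Fintype K]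

/-- The Fourier coefficients of `Ξ_0(x, χ_D)`, indexed by all integers. -/
noncomputable def xiCoeff (D : K[X]) (n : ℤ) : ℂ :=
  if n.natAbs ≤ genus D then (fourierPhi D n.natAbs : ℂ) else 0

theorem isHermitianSeq_xiCoeff (D : K[X]) : IsHermitianSeq (xiCoeff D) := by
  intro n
  simp only [xiCoeff, Int.natAbs_neg]
  split_ifs <;> simp

theorem xiCoeff_eq_zero (D : K[X]) {n : ℤ}
    (hn : n ∉ Finset.Icc (-(genus D : ℤ)) (genus D)) : xiCoeff D n = 0 := by
  refine if_neg fun h => hn ?_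
  rw [Finset.mem_Icc]
  omega

theorem superGaussian_xiCoeff (D : K[X]) : SuperGaussian (xiCoeff D) := fun T =>
  summable_of_ne_finset_zero (s := Finset.Icc (-(genus D : ℤ)) (genus D)) fun n hn => by
    rw [xiCoeff_eq_zero D hn, norm_zero, zero_mul]

theorem Finset.sum_Icc_neg_natCast {M : Type*} [AddCommMonoid M] (f : ℤ → M) (g : ℕ) :
    ∑ n ∈ Finset.Icc (-(g : ℤ)) g, f n =
      f 0 + ∑ n ∈ Finset.Icc 1 g, (f n + f (-n)) := by
  induction g with
  | zero => simp
  | succ g ih =>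
    have hI : Finset.Icc (-((g + 1 : ℕ) : ℤ)) ((g + 1 : ℕ) : ℤ) =
        insert ((g + 1 : ℕ) : ℤ) (insert (-((g + 1 : ℕ) : ℤ)) (Finset.Icc (-(g : ℤ)) g)) := by
      ext n
      simp only [Finset.mem_insert, Finset.mem_Icc]
      omega
    rw [hI, Finset.sum_insert (by simp only [Finset.mem_insert, Finset.mem_Icc]; omega),
      Finset.sum_insert (by simp only [Finset.mem_Icc]; omega), ih,
      Finset.sum_Icc_succ_top (by omega)]
    abel

/-- The coefficients are even in `n`, so the terms `n` and `-n` of the finite two-sided sum combine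
into `e^{inx} + e^{-inx}`. -/
theorem Xi_eq_trigSeries (D : K[X]) (t : ℝ) : Xi D t = trigSeries (deform t (xiCoeff D)) := by
  ext x
  rw [trigSeries, tsum_eq_sum (s := Finset.Icc (-(genus D : ℤ)) (genus D)) fun n hn => by
    rw [deform, xiCoeff_eq_zero D hn, zero_mul, zero_mul], Finset.sum_Icc_neg_natCast, Xi]
  congr 1
  · simp [deform, xiCoeff]
  · refine Finset.sum_congr rfl fun n hn => ?_
    have hn' := (Finset.mem_Icc.1 hn).2
    simp [deform, xiCoeff, hn', mul_add]

end FunctionField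

theorem mainTheorem4 :
    (∀ (F : ℤ → ℂ) (ε : ℝ), 0 < ε →
      Summable (fun n : ℤ => ‖F n‖) →
      (∀ n : ℤ, F n = (starRingEnd ℂ) (F (-n))) →
      F =O[cofinite] (fun n : ℤ => Real.exp (-(|(n : ℝ)| ^ (2 + ε)))) →
      -- the series below converge absolutely, for all times and all complex arguments
      (∀ (t : ℝ) (z : ℂ),
        Summable (fun n : ℤ => ‖deform t F n * Complex.exp (Complex.I * n * z)‖)) ∧
      -- zeros in a strip at time `0` give zeros in a narrower strip at time `t ≥ 0`
      (∀ Δ : ℝ, 0 ≤ Δ →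
        (∀ z : ℂ, trigSeries F z = 0 → |z.im| ≤ Δ) →
        ∀ t : ℝ, 0 ≤ t →
          ∀ z : ℂ, trigSeries (deform t F) z = 0 → |z.im| ≤ √(max (Δ ^ 2 - 2 * t) 0)) ∧
      -- zeros that are real at some time stay real at all later times
      (∀ t t' : ℝ, t < t' →
        OnlyRealZeros (trigSeries (deform t F)) → OnlyRealZeros (trigSeries (deform t' F)))) ∧
    -- the same for the quadratic Dirichlet `L`-functions over a rational function field
    (∀ (K : Type*) [Field K] [Fintype K] (D : K[X]), IsGoodPair K D →
      ∀ t t' : ℝ, t < t' → OnlyRealZeros (Xi D t) → OnlyRealZeros (Xi D t')) := by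
  refine ⟨fun F ε hε _ hH hO => ?_, fun K _ _ D _ t t' htt' h => ?_⟩
  · have hF := superGaussian_of_isBigO hε hO
    exact ⟨fun t z => (hF.deform t).summable_trig z,
      fun Δ hΔ hz t ht z h0 => abs_im_le_of_trigSeries_deform_eq_zero hF hH hΔ hz ht z h0,
      fun t t' htt' h => onlyRealZeros_deform_of_lt hF hH htt' h⟩
  · rw [Xi_eq_trigSeries] at h ⊢
    exact onlyRealZeros_deform_of_lt (superGaussian_xiCoeff D) (isHermitianSeq_xiCoeff D) htt' h
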